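/- For a topological space $X$, a continuous valuation on $X$ is a map $\nu:\mathcal O(X)\to[0,\infty]$ on the open sets that is strict ($\nu(\varnothing)=0$), monotone, modular ($\nu(U\cup W)+\nu(U\cap W)=\nu(U)+\nu(W)$) and Scott-continuous ($\nu(\bigcup_\lambda U_\lambda)=\sup_\lambda\nu(U_\lambda)$ for directed families). Let $VX$ be the set of continuous valuations on $X$ with the weak topology, generated by the sets $\{\nu : \nu(U)>r\}$ for $U\subseteq X$ open and $r\in[0,\infty)$. For a continuous map $f:X\to Y$ let $f_*:VX\to VY$ be the pushforward, $f_*\nu(U)=\nu(f^{-1}(U))$; this makes $V$ a functor $\mathsf{Top}\to\mathsf{Top}$. Let $LX$ be the set of lower semicontinuous functions $X\to[0,\infty]$ with the pointwise order and operations. For $\nu\in VX$ and $g\in LX$ let $\langle\nu,g\rangle=\int g\,d\nu$ be the lower integral, that is, the supremum of $\sum_{i=1}^n r_i\,\nu(U_i)$ over all finite families $r_i\in[0,\infty]$, $U_i\subseteq X$ open, with $\sum_{i=1}^n r_i 1_{U_i}\le g$. For $g\in LX$ the function $\langle-,g\rangle:VX\to[0,\infty]$ is lower semicontinuous. Theorem.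 (i) For every topological space $X$, the assignment $\nu\mapsto\langle\nu,-\rangle$ is a bijection from $VX$ onto the set of $[0,\infty]$-linear Scott-continuous functionals $LX\to[0,\infty]$. (ii) There are natural transformations $\delta:\mathrm{id}\Rightarrow V$ and $\mathcal E:VV\Rightarrow V$ of functors $\mathsf{Top}\to\mathsf{Top}$ such that, for every space $X$, every $x\in X$ and every $\xi\in VVX$, $\delta_x$ is the unique element of $VX$ with $\langle\delta_x,g\rangle=g(x)$ for all $g\in LX$, and $\mathcal E\xi$ is the unique element of $VX$ with $\langle\mathcal E\xi,g\rangle=\langle\xi,\langle-,g\rangle\rangle$ for all $g\in LX$. With these, the triple $(V,\delta,\mathcal E)$ is a monad on $\mathsf{Top}$. -/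

import Mathlib

open CategoryTheory TopologicalSpace
open scoped ENNReal NNReal

universe u

/-- A continuous valuation on a topological space `X`: a strict, monotone, modular and
Scott-continuous map from the lattice of open sets of `X` to `[0,∞]`. -/
@[ext]
structure ContinuousValuation (X : Type u) [TopologicalSpace X] where
  /-- The value of the valuation on an open set. -/
  toFun : Opens X → ℝ≥0∞
  strict' : toFun ⊥ = 0
  mono' : ∀ U V : Opens X, U ≤ V → toFun U ≤ toFun V
  modular' : ∀ U V : Opens X, toFun (U ⊔ V) + toFun (U ⊓ V) = toFun U + toFun V
  scott' : ∀ S : Set (Opens X), S.Nonempty → DirectedOn (· ≤ ·) S →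
    toFun (sSup S) = ⨆ U ∈ S, toFun U

/-- The set of lower semicontinuous functions `X → [0,∞]`, as a sub-`[0,∞]`-module of all
functions; it carries the pointwise order and the pointwise operations. -/
def Lsc (X : Type u) [TopologicalSpace X] : Submodule ℝ≥0∞ (X → ℝ≥0∞) where
  carrier := {g | LowerSemicontinuous g}
  zero_mem' := lowerSemicontinuous_const
  add_mem' := fun hf hg => LowerSemicontinuous.add hf hg
  smul_mem' := by
    intro c g hg
    have hg' : LowerSemicontinuous g := hg
    rcases eq_or_ne c ∞ with rfl | hc
    · have h : (∞ : ℝ≥0∞) • g = (g ⁻¹' Set.Ioi 0).indicator (fun _ => ∞) := by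
        funext x
        by_cases hx : g x = 0
        · simp [hx]
        · have hx' : x ∈ g ⁻¹' Set.Ioi 0 := pos_iff_ne_zero.2 hx
          rw [Set.indicator_of_mem hx']
          simp [ENNReal.top_mul hx]
      change LowerSemicontinuous ((∞ : ℝ≥0∞) • g)
      rw [h]
      exact (hg'.isOpen_preimage 0).lowerSemicontinuous_indicator bot_le
    · exact (ENNReal.continuous_const_mul hc).comp_lowerSemicontinuous hg'
        (fun a b hab => mul_le_mul_right hab c)

namespace ContinuousValuation

/-- The integral `⟨ν, g⟩ = ∫ g dν` of a lower semicontinuous function `g : X → [0,∞]` against a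
continuous valuation `ν`: the supremum of `∑ i, r i * ν (U i)` over all simple functions
`∑ i, r i • 1_{U i}` (with `r i ∈ [0,∞]`, `U i` open) that lie below `g`. -/
noncomputable def pairing {X : Type u} [TopologicalSpace X] (ν : ContinuousValuation X)
    (g : Lsc X) : ℝ≥0∞ :=
  sSup {s : ℝ≥0∞ | ∃ (n : ℕ) (r : Fin n → ℝ≥0∞) (U : Fin n → Opens X),
    (∀ x : X, ∑ i, r i * Set.indicator (U i : Set X) (fun _ => (1 : ℝ≥0∞)) x ≤ g.1 x) ∧
      s = ∑ i, r i * ν.toFun (U i)}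

/-- The weak topology on the set `VX` of continuous valuations on `X`: it is generated by the sets
`θ(U,r) = {ν | ν(U) > r}` for `U` open in `X` and `r ∈ [0,∞)`. -/
instance weakTopology (X : Type u) [TopologicalSpace X] :
    TopologicalSpace (ContinuousValuation X) :=
  generateFrom {A | ∃ (U : Opens X) (r : ℝ≥0), A = {ν | (r : ℝ≥0∞) < ν.toFun U}}

theorem lowerSemicontinuous_apply {X : Type u} [TopologicalSpace X] (U : Opens X) :
    LowerSemicontinuous (fun ν : ContinuousValuation X => ν.toFun U) := by
  rw [lowerSemicontinuous_iff_isOpen_preimage]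
  intro y
  rcases eq_or_ne y ∞ with rfl | hy
  · simp
  · lift y to ℝ≥0 using hy
    exact isOpen_generateFrom_of_mem ⟨U, y, rfl⟩

/-- The function `⟨-, g⟩ : VX → [0,∞]`, as a lower semicontinuous function on `VX`. -/
noncomputable def evalLsc {X : Type u} [TopologicalSpace X] (g : Lsc X) :
    Lsc (ContinuousValuation X) :=
  ⟨fun ν => ν.pairing g, by
    change LowerSemicontinuous fun ν : ContinuousValuation X => ν.pairing g
    intro ν y hy
    obtain ⟨s, ⟨n, r, U, hle, rfl⟩, hs⟩ := lt_sSup_iff.1 hy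
    have key : (∑ i, r i • fun ρ : ContinuousValuation X => ρ.toFun (U i)) ∈
        Lsc (ContinuousValuation X) :=
      Submodule.sum_mem _ fun i _ =>
        Submodule.smul_mem _ _ (lowerSemicontinuous_apply (U i))
    have key' : LowerSemicontinuous
        (∑ i, r i • fun ρ : ContinuousValuation X => ρ.toFun (U i)) := key
    have h := key' ν y (by simpa using hs)
    filter_upwards [h] with ρ hρ
    refine lt_of_lt_of_le hρ (le_sSup ⟨n, r, U, hle, ?_⟩)
    simp⟩

/-- The pushforward `f_* ν` of a continuous valuation along a continuous map `f`:
`f_* ν (U) = ν (f⁻¹ U)`. -/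
def pushforward {X Y : Type u} [TopologicalSpace X] [TopologicalSpace Y] (f : C(X, Y))
    (ν : ContinuousValuation X) : ContinuousValuation Y where
  toFun U := ν.toFun (Opens.comap f U)
  strict' := ν.strict'
  mono' U V h := ν.mono' _ _ (Opens.comap_mono f h)
  modular' U V := ν.modular' (Opens.comap f U) (Opens.comap f V)
  scott' S hne hS := by
    rw [map_sSup, ν.scott' _ (hne.image _), iSup_image]
    rintro _ ⟨U, hU, rfl⟩ _ ⟨V, hV, rfl⟩
    obtain ⟨W, hW, h1, h2⟩ := hS U hU V hV
    exact ⟨_, ⟨W, hW, rfl⟩, Opens.comap_mono f h1, Opens.comap_mono f h2⟩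

theorem continuous_pushforward {X Y : Type u} [TopologicalSpace X] [TopologicalSpace Y]
    (f : C(X, Y)) : Continuous (pushforward f) := by
  refine continuous_generateFrom_iff.2 ?_
  rintro _ ⟨U, r, rfl⟩
  exact isOpen_generateFrom_of_mem ⟨Opens.comap f U, r, rfl⟩

end ContinuousValuation

/-- The functor `V : Top ⥤ Top`: it sends a space `X` to the space `VX` of continuous valuations on
`X` with the weak topology, and a continuous map `f` to the pushforward `f_*`. -/
def valuationFunctor : TopCat.{u} ⥤ TopCat.{u} where
  obj X := TopCat.of (ContinuousValuation X)
  map f := TopCat.ofHom ⟨ContinuousValuation.pushforward f.hom,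
    ContinuousValuation.continuous_pushforward f.hom⟩
  map_id _ := rfl
  map_comp _ _ := rfl

/-! A functional is determined by its values on indicators: every lower semicontinuous `g` is the
increasing supremum of `2⁻ⁿ ∑_{k ≥ 1} 1_{2ⁿ g > k}`, and the strict inequalities keep the sets open.
Conversely, a linear Scott-continuous functional restricted to indicators is a valuation. Hence (i)
reduces to the lower integral being linear and Scott-continuous.

Scott continuity is visible on the sums `∑ ν{g > k}`, so the integral is rewritten as a supremum of
dyadic Riemann sums. Additivity is the hard point. Modularity makes `upperSum` exact on sums of
indicators (`upperSum_add_indicator`), so the upper sum of `floor f + floor g` is the sum of the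
lower sums of `f` and `g`. Superadditivity of `floor` then yields one inequality; lower sum at most
upper sum yields the other on dyadic approximants, and directed suprema extend it.

For (ii), evaluation at a point and iterated integration are linear and Scott-continuous, hence
represented by valuations. Naturality and the monad laws are checked by pairing with an arbitrary
`g`. -/

namespace ENNReal

/-! ### Dyadic approximation in `[0,∞]` -/

theorem tsum_iSup_of_directed {α ι : Type*} {f : α → ι → ℝ≥0∞}
    (h : ∀ i j, ∃ k, ∀ a, f a i ≤ f a k ∧ f a j ≤ f a k) :
    ∑' a, ⨆ i, f a i = ⨆ i, ∑' a, f a i := by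
  simp_rw [ENNReal.tsum_eq_iSup_sum]
  rw [iSup_comm]
  exact iSup_congr fun s => finsetSum_iSup h

/-- The number of integers `m ≥ 1` with `m < a`. -/
noncomputable def countBelow (a : ℝ≥0∞) : ℝ≥0∞ :=
  ∑' k : ℕ, if (k + 1 : ℝ≥0∞) < a then 1 else 0

/-- The integers counted form an initial segment. Working with natural partial counts avoids a
separate case `a = ∞` in the estimates below. -/
theorem exists_nat_sum_range_eq (a : ℝ≥0∞) (N : ℕ) :
    ∃ p : ℕ, ∑ k ∈ Finset.range N, (if (k + 1 : ℝ≥0∞) < a then (1 : ℝ≥0∞) else 0) = p ∧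
      (p = 0 ∨ (p : ℝ≥0∞) < a) := by
  induction N with
  | zero => exact ⟨0, by simp⟩
  | succ N ih =>
    by_cases h : (N + 1 : ℝ≥0∞) < a
    · refine ⟨N + 1, ?_, Or.inr (by exact_mod_cast h)⟩
      rw [Finset.sum_congr rfl (g := fun _ => (1 : ℝ≥0∞))]
      · simp
      · intro k hk
        refine if_pos (lt_of_le_of_lt ?_ h)
        have : k ≤ N := Nat.lt_succ_iff.1 (Finset.mem_range.1 hk)
        gcongr
    · simpa only [Finset.sum_range_succ, h, if_false, add_zero] using ih

theorem natCast_le_countBelow {a : ℝ≥0∞} {n : ℕ} (h : n = 0 ∨ (n : ℝ≥0∞) < a) :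
    (n : ℝ≥0∞) ≤ countBelow a := by
  rcases h with rfl | h
  · simp
  · refine le_trans (le_of_eq ?_) (ENNReal.sum_le_tsum (Finset.range n))
    rw [Finset.sum_congr rfl (g := fun _ => (1 : ℝ≥0∞))]
    · simp
    · intro k hk
      refine if_pos (lt_of_le_of_lt ?_ h)
      exact_mod_cast Finset.mem_range.1 hk

theorem countBelow_mono : Monotone countBelow := by
  intro a b hab
  refine ENNReal.tsum_le_tsum fun k => ?_
  by_cases h : (k + 1 : ℝ≥0∞) < a
  · simp [h, h.trans_le hab]
  · simp [h]

/-- From `p < a` and `q < b` follows `p + q < a + b`. A zero count is treated apart, since `0 < a`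
may then fail. -/
theorem countBelow_add_le (a b : ℝ≥0∞) :
    countBelow a + countBelow b ≤ countBelow (a + b) := by
  have key : ∀ N, ∑ k ∈ Finset.range N, (if (k + 1 : ℝ≥0∞) < a then (1 : ℝ≥0∞) else 0) +
      ∑ k ∈ Finset.range N, (if (k + 1 : ℝ≥0∞) < b then (1 : ℝ≥0∞) else 0) ≤
        countBelow (a + b) := by
    intro N
    obtain ⟨p, hp, hpa⟩ := exists_nat_sum_range_eq a N
    obtain ⟨q, hq, hqb⟩ := exists_nat_sum_range_eq b N
    rw [hp, hq]
    rcases hpa with rfl | hpa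
    · simpa using (natCast_le_countBelow hqb).trans (countBelow_mono le_add_self)
    rcases hqb with rfl | hqb
    · simpa using (natCast_le_countBelow (Or.inr hpa)).trans (countBelow_mono le_self_add)
    · exact_mod_cast natCast_le_countBelow (n := p + q)
        (Or.inr (by push_cast; exact ENNReal.add_lt_add hpa hqb))
  unfold countBelow at key ⊢
  rw [ENNReal.tsum_eq_iSup_nat, ENNReal.tsum_eq_iSup_nat, ENNReal.iSup_add_iSup_of_monotone]
  · exact iSup_le key
  · exact fun m n h => Finset.sum_le_sum_of_subset (Finset.range_mono h)
  · exact fun m n h => Finset.sum_le_sum_of_subset (Finset.range_mono h)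

theorem countBelow_le (a : ℝ≥0∞) : countBelow a ≤ a := by
  unfold countBelow
  rw [ENNReal.tsum_eq_iSup_nat]
  refine iSup_le fun N => ?_
  obtain ⟨p, hp, rfl | hpa⟩ := exists_nat_sum_range_eq a N
  · simp [hp]
  · exact hp ▸ hpa.le

theorem le_countBelow_add_one (a : ℝ≥0∞) : a ≤ countBelow a + 1 := by
  rcases eq_or_ne a ∞ with rfl | ha
  · have : countBelow ∞ = ∞ := ENNReal.eq_top_of_forall_nnreal_le fun r => by
      obtain ⟨n, hn⟩ := exists_nat_ge r
      refine le_trans ?_ (natCast_le_countBelow (n := n) (Or.inr (ENNReal.natCast_lt_top n)))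
      exact_mod_cast hn
    simp [this]
  · lift a to ℝ≥0 using ha
    -- For `a > 0`, `⌈a⌉₊ - 1` is the largest natural number strictly below `a`; at `a = 0`
    -- truncated subtraction gives the harmless value `0`.
    have h : ((⌈a⌉₊ - 1 : ℕ) : ℝ≥0∞) ≤ countBelow a := by
      refine natCast_le_countBelow ?_
      rcases Nat.eq_zero_or_pos (⌈a⌉₊ - 1) with h | h
      · exact Or.inl h
      · right
        exact_mod_cast Nat.lt_ceil.1 (by omega : ⌈a⌉₊ - 1 < ⌈a⌉₊)
    refine le_trans ?_ (add_le_add_left h 1)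
    have h1 : a ≤ ((⌈a⌉₊ - 1 + 1 : ℕ) : ℝ≥0) :=
      (Nat.le_ceil a).trans (by exact_mod_cast (by omega : ⌈a⌉₊ ≤ ⌈a⌉₊ - 1 + 1))
    exact_mod_cast h1

theorem inv_two_pow_succ_mul_add_self (n : ℕ) (c : ℝ≥0∞) :
    (2 ^ (n + 1) : ℝ≥0∞)⁻¹ * (c + c) = (2 ^ n)⁻¹ * c := by
  rw [← two_mul, ← mul_assoc, pow_succ, ENNReal.mul_inv (by simp) (by simp), mul_assoc _ 2⁻¹,
    ENNReal.inv_mul_cancel (by simp) (by simp), mul_one]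

theorem inv_two_pow_mul_cancel (n : ℕ) (a : ℝ≥0∞) : (2 ^ n : ℝ≥0∞)⁻¹ * (2 ^ n * a) = a := by
  rw [← mul_assoc, ENNReal.inv_mul_cancel (by simp) (by simp), one_mul]

theorem monotone_dyadic_countBelow (a : ℝ≥0∞) :
    Monotone fun n : ℕ => (2 ^ n : ℝ≥0∞)⁻¹ * countBelow (2 ^ n * a) := by
  refine monotone_nat_of_le_succ fun n => ?_
  rw [← inv_two_pow_succ_mul_add_self]
  gcongr
  refine (countBelow_add_le _ _).trans_eq ?_
  rw [← two_mul, ← mul_assoc, pow_succ']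

theorem iSup_dyadic_countBelow (a : ℝ≥0∞) :
    ⨆ n : ℕ, (2 ^ n : ℝ≥0∞)⁻¹ * countBelow (2 ^ n * a) = a := by
  refine le_antisymm (iSup_le fun n => ?_) ?_
  · calc (2 ^ n : ℝ≥0∞)⁻¹ * countBelow (2 ^ n * a) ≤ (2 ^ n)⁻¹ * (2 ^ n * a) := by
          gcongr; exact countBelow_le _
      _ = a := inv_two_pow_mul_cancel n a
  · set S := ⨆ n : ℕ, (2 ^ n : ℝ≥0∞)⁻¹ * countBelow (2 ^ n * a)
    have h : ∀ n : ℕ, a ≤ S + 2⁻¹ ^ n := fun n =>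
      calc a = (2 ^ n)⁻¹ * (2 ^ n * a) := (inv_two_pow_mul_cancel n a).symm
        _ ≤ (2 ^ n)⁻¹ * (countBelow (2 ^ n * a) + 1) := by
          gcongr; exact le_countBelow_add_one _
        _ = (2 ^ n)⁻¹ * countBelow (2 ^ n * a) + 2⁻¹ ^ n := by
          rw [mul_add, mul_one, ENNReal.inv_pow]
        _ ≤ S + 2⁻¹ ^ n := by
          gcongr; exact le_iSup (fun n : ℕ => (2 ^ n : ℝ≥0∞)⁻¹ * countBelow (2 ^ n * a)) n
    have hlim : Filter.Tendsto (fun n : ℕ => S + (2⁻¹ : ℝ≥0∞) ^ n) Filter.atTop (nhds (S + 0)) :=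
      tendsto_const_nhds.add
        (ENNReal.tendsto_pow_atTop_nhds_zero_of_lt_one (by simp))
    simpa using ge_of_tendsto' hlim h

end ENNReal

/-! ### Directed suprema and indicator expansions of lower semicontinuous functions -/

namespace Lsc

variable {X : Type u} [TopologicalSpace X]

/-- The pointwise supremum of a family of lower semicontinuous functions. -/
noncomputable def iSup {ι : Type*} (g : ι → Lsc X) : Lsc X :=
  ⟨fun x => ⨆ i, (g i).1 x, lowerSemicontinuous_iSup fun i => (g i).2⟩

theorem isLUB_iSup {ι : Type*} (g : ι → Lsc X) : IsLUB (Set.range g) (Lsc.iSup g) := by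
  constructor
  · rintro _ ⟨i, rfl⟩ x
    exact le_iSup (fun i => (g i).1 x) i
  · exact fun b hb x => iSup_le fun i => hb ⟨i, rfl⟩ x

theorem _root_.ScottContinuous.map_lscSup {Φ : Lsc X → ℝ≥0∞} (hΦ : ScottContinuous Φ)
    {ι : Type*} [Nonempty ι] {g : ι → Lsc X} (hg : Directed (· ≤ ·) g) :
    Φ (Lsc.iSup g) = ⨆ i, Φ (g i) := by
  have h := hΦ (Set.range_nonempty g) hg.directedOn_range (isLUB_iSup g)
  rw [← h.sSup_eq, ← Set.range_comp, sSup_range]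
  rfl

/-- Pointwise suprema of lower semicontinuous functions are again lower semicontinuous, so any least
upper bound is the pointwise one. A directed set can index itself, so index types in `Type u`
suffice. -/
theorem scottContinuous_of_map_iSup {Φ : Lsc X → ℝ≥0∞}
    (h : ∀ (ι : Type u) (_ : Nonempty ι) (g : ι → Lsc X), Directed (· ≤ ·) g →
      Φ (Lsc.iSup g) = ⨆ i, Φ (g i)) : ScottContinuous Φ := by
  intro d hne hd a ha
  have : a = Lsc.iSup (Subtype.val : d → Lsc X) :=
    ha.unique (by simpa using isLUB_iSup (Subtype.val : d → Lsc X))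
  rw [this, h d hne.to_subtype _ hd.directed_val, ← sSup_image']
  exact isLUB_sSup _

theorem scottContinuous_eval (x : X) : ScottContinuous fun g : Lsc X => g.1 x :=
  scottContinuous_of_map_iSup fun _ _ _ _ => rfl

theorem _root_.ScottContinuous.iSup_ennreal {κ : Sort*} {Φ : κ → Lsc X → ℝ≥0∞}
    (h : ∀ k, ScottContinuous (Φ k)) : ScottContinuous fun g => ⨆ k, Φ k g :=
  scottContinuous_of_map_iSup fun _ _ _ hg => by
    simp_rw [fun k => (h k).map_lscSup hg]
    exact iSup_comm

theorem _root_.ScottContinuous.tsum_ennreal {κ : Type*} {Φ : κ → Lsc X → ℝ≥0∞}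
    (h : ∀ k, ScottContinuous (Φ k)) : ScottContinuous fun g => ∑' k, Φ k g :=
  scottContinuous_of_map_iSup fun _ _ _ hg => by
    simp_rw [fun k => (h k).map_lscSup hg]
    refine ENNReal.tsum_iSup_of_directed fun i j => ?_
    obtain ⟨k, hik, hjk⟩ := hg i j
    exact ⟨k, fun a => ⟨(h a).monotone hik, (h a).monotone hjk⟩⟩

theorem _root_.ScottContinuous.const_mul_ennreal {Φ : Lsc X → ℝ≥0∞} (h : ScottContinuous Φ)
    (c : ℝ≥0∞) : ScottContinuous fun g => c * Φ g :=
  scottContinuous_of_map_iSup fun _ _ _ hg => by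
    simp_rw [h.map_lscSup hg, ENNReal.mul_iSup]

theorem smul_le_smul_left (c : ℝ≥0∞) {f g : Lsc X} (h : f ≤ g) : c • f ≤ c • g :=
  fun x => mul_le_mul_right (h x) c

theorem smul_iSup (c : ℝ≥0∞) {ι : Type*} (g : ι → Lsc X) :
    c • Lsc.iSup g = Lsc.iSup fun i => c • g i :=
  Subtype.ext <| funext fun _ => ENNReal.mul_iSup ..

theorem _root_.ScottContinuous.comp_smul {Φ : Lsc X → ℝ≥0∞} (h : ScottContinuous Φ)
    (c : ℝ≥0∞) : ScottContinuous fun g => Φ (c • g) :=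
  scottContinuous_of_map_iSup fun _ _ g hg => by
    rw [smul_iSup]
    exact h.map_lscSup fun i j => (hg i j).imp fun _ hk =>
      ⟨smul_le_smul_left c hk.1, smul_le_smul_left c hk.2⟩

/-- The indicator function of an open set. -/
noncomputable def indicator (U : Opens X) : Lsc X :=
  ⟨(U : Set X).indicator fun _ => 1, U.isOpen.lowerSemicontinuous_indicator zero_le_one⟩

open Classical in
theorem indicator_apply (U : Opens X) (x : X) : (indicator U).1 x = if x ∈ U then 1 else 0 :=
  Set.indicator_apply (U : Set X) (fun _ => (1 : ℝ≥0∞)) x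

/-- The open set where a lower semicontinuous function exceeds `c`. -/
def superlevel (g : Lsc X) (c : ℝ≥0∞) : Opens X := ⟨{x | c < g.1 x}, g.2.isOpen_preimage c⟩

@[simp]
theorem mem_superlevel {g : Lsc X} {c : ℝ≥0∞} {x : X} : x ∈ superlevel g c ↔ c < g.1 x := Iff.rfl

theorem superlevel_mono (c : ℝ≥0∞) {f g : Lsc X} (h : f ≤ g) : superlevel f c ≤ superlevel g c :=
  fun x hx => lt_of_lt_of_le hx (h x)

theorem superlevel_anti (g : Lsc X) {c d : ℝ≥0∞} (h : c ≤ d) : superlevel g d ≤ superlevel g c :=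
  fun _ hx => lt_of_le_of_lt h hx

theorem superlevel_iSup {ι : Type*} (g : ι → Lsc X) (c : ℝ≥0∞) :
    superlevel (Lsc.iSup g) c = ⨆ i, superlevel (g i) c := by
  ext x
  simp [Lsc.iSup, lt_iSup_iff]

/-- The sum of the indicator functions of a family of open sets. -/
noncomputable def indicatorSum {ι : Type*} (U : ι → Opens X) : Lsc X :=
  ⟨fun x => ∑' i, (indicator (U i)).1 x, lowerSemicontinuous_tsum fun i => (indicator (U i)).2⟩

theorem coe_sum_apply {ι : Type*} (s : Finset ι) (g : ι → Lsc X) (x : X) :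
    (∑ i ∈ s, g i).1 x = ∑ i ∈ s, (g i).1 x := by
  simp

theorem directed_sum {ι : Type*} (g : ι → Lsc X) :
    Directed (· ≤ ·) fun s : Finset ι => ∑ i ∈ s, g i := by
  classical
  refine fun s t => ⟨s ∪ t, fun x => ?_, fun x => ?_⟩ <;> simp only [coe_sum_apply]
  · exact Finset.sum_le_sum_of_subset Finset.subset_union_left
  · exact Finset.sum_le_sum_of_subset Finset.subset_union_right

theorem indicatorSum_eq_iSup {ι : Type*} (U : ι → Opens X) :
    indicatorSum U = Lsc.iSup fun s : Finset ι => ∑ i ∈ s, indicator (U i) :=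
  Subtype.ext <| funext fun x => by
    simp only [indicatorSum, Lsc.iSup, coe_sum_apply, ENNReal.tsum_eq_iSup_sum]

theorem indicatorSum_add {ι κ : Type*} (U : ι → Opens X) (W : κ → Opens X) :
    indicatorSum (Sum.elim U W) = indicatorSum U + indicatorSum W :=
  Subtype.ext <| funext fun x => by
    simp [indicatorSum, Summable.tsum_sum, ENNReal.summable]

/-- The largest integer-valued function strictly below `g` wherever `g` is positive and finite. -/
noncomputable def floor (g : Lsc X) : Lsc X := indicatorSum fun k : ℕ => superlevel g (k + 1)

theorem floor_apply (g : Lsc X) (x : X) : (floor g).1 x = ENNReal.countBelow (g.1 x) := by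
  simp [floor, indicatorSum, indicator_apply, ENNReal.countBelow]

theorem floor_add_le (f g : Lsc X) : floor f + floor g ≤ floor (f + g) := fun x => by
  simpa [floor_apply] using ENNReal.countBelow_add_le (f.1 x) (g.1 x)

/-- The approximation of `g` from below by a function with values in `2⁻ⁿ ℕ`. -/
noncomputable def dyadic (n : ℕ) (g : Lsc X) : Lsc X := (2 ^ n : ℝ≥0∞)⁻¹ • floor ((2 : ℝ≥0∞) ^ n • g)

theorem dyadic_apply (n : ℕ) (g : Lsc X) (x : X) :
    (dyadic n g).1 x = (2 ^ n : ℝ≥0∞)⁻¹ * ENNReal.countBelow (2 ^ n * g.1 x) := by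
  exact congrArg ((2 ^ n : ℝ≥0∞)⁻¹ * ·) (floor_apply ((2 : ℝ≥0∞) ^ n • g) x)

theorem monotone_dyadic (g : Lsc X) : Monotone fun n => dyadic n g := fun m n h x => by
  simpa only [dyadic_apply] using ENNReal.monotone_dyadic_countBelow (g.1 x) h

theorem iSup_dyadic (g : Lsc X) : Lsc.iSup (fun n => dyadic n g) = g :=
  Subtype.ext <| funext fun x => by
    simpa only [Lsc.iSup, dyadic_apply] using ENNReal.iSup_dyadic_countBelow (g.1 x)

/-- A Scott-continuous linear functional is determined by its values on indicator functions. -/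
theorem _root_.IsLinearMap.eq_iSup_of_scottContinuous {Φ : Lsc X → ℝ≥0∞}
    (hl : IsLinearMap ℝ≥0∞ Φ) (hs : ScottContinuous Φ) (g : Lsc X) :
    Φ g = ⨆ n : ℕ, (2 ^ n : ℝ≥0∞)⁻¹ *
      ∑' k : ℕ, Φ (indicator (superlevel ((2 : ℝ≥0∞) ^ n • g) (k + 1))) := by
  conv_lhs => rw [← iSup_dyadic g, hs.map_lscSup (monotone_dyadic g).directed_le]
  refine iSup_congr fun n => ?_
  rw [dyadic, hl.map_smul, smul_eq_mul, floor, indicatorSum_eq_iSup,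
    hs.map_lscSup (directed_sum _), ENNReal.tsum_eq_iSup_sum]
  congr 1
  exact iSup_congr fun s => map_sum (hl.mk' Φ) _ _

theorem _root_.IsLinearMap.ext_of_scottContinuous {Φ Ψ : Lsc X → ℝ≥0∞}
    (hΦ : IsLinearMap ℝ≥0∞ Φ) (hΦ' : ScottContinuous Φ)
    (hΨ : IsLinearMap ℝ≥0∞ Ψ) (hΨ' : ScottContinuous Ψ)
    (h : ∀ U, Φ (indicator U) = Ψ (indicator U)) : Φ = Ψ := by
  funext g
  rw [hΦ.eq_iSup_of_scottContinuous hΦ', hΨ.eq_iSup_of_scottContinuous hΨ']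
  simp only [h]

end Lsc

/-! ### Riemann sums of a valuation and additivity of the integral -/

namespace ContinuousValuation

open Lsc

variable {X : Type u} [TopologicalSpace X] (ν : ContinuousValuation X)

theorem map_iSup {ι : Type*} [Nonempty ι] {U : ι → Opens X} (hU : Directed (· ≤ ·) U) :
    ν.toFun (⨆ i, U i) = ⨆ i, ν.toFun (U i) := by
  rw [_root_.iSup, ν.scott' _ (Set.range_nonempty U) hU.directedOn_range, iSup_range]

theorem scottContinuous_superlevel (c : ℝ≥0∞) :
    ScottContinuous fun g : Lsc X => ν.toFun (superlevel g c) :=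
  scottContinuous_of_map_iSup fun _ _ g hg => by
    rw [superlevel_iSup, ν.map_iSup]
    exact fun i j => (hg i j).imp fun _ hk => ⟨superlevel_mono c hk.1, superlevel_mono c hk.2⟩

/-- The upper Riemann sum of mesh `1` for the integral of `g`. -/
noncomputable def upperSum (g : Lsc X) : ℝ≥0∞ := ∑' k : ℕ, ν.toFun (superlevel g k)

/-- The lower Riemann sum of mesh `1` for the integral of `g`. -/
noncomputable def lowerSum (g : Lsc X) : ℝ≥0∞ := ∑' k : ℕ, ν.toFun (superlevel g (k + 1))

theorem scottContinuous_upperSum : ScottContinuous ν.upperSum :=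
  ScottContinuous.tsum_ennreal fun _ => ν.scottContinuous_superlevel _

theorem scottContinuous_lowerSum : ScottContinuous ν.lowerSum :=
  ScottContinuous.tsum_ennreal fun _ => ν.scottContinuous_superlevel _

theorem lowerSum_le_upperSum (g : Lsc X) : ν.lowerSum g ≤ ν.upperSum g :=
  ENNReal.tsum_le_tsum fun _ => ν.mono' _ _ (superlevel_anti g le_self_add)

/-- For integer-valued `f`, `{f + 1_W > k+1} = {f > k+1} ∪ ({f > k} ∩ W)`. Modularity at each level
and summation over `k` telescope the terms `ν({f > k} ∩ W)`, leaving `ν(W)`. The bound `n` makes the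
cancelled sum finite when `ν(W)` is. -/
theorem upperSum_add_indicator (f : Lsc X) (W : Opens X) (n : ℕ)
    (hf : ∀ x, ∃ m : ℕ, m ≤ n ∧ f.1 x = m) :
    ν.upperSum (f + indicator W) = ν.upperSum f + ν.toFun W := by
  classical
  have hadd : ∀ x, (f + indicator W).1 x = f.1 x + if x ∈ W then 1 else 0 := fun x => by
    rw [← indicator_apply]; rfl
  have e0 : superlevel (f + indicator W) 0 = superlevel f 0 ⊔ W := by
    ext x
    simp only [SetLike.mem_coe, mem_superlevel, Opens.mem_sup, hadd]
    by_cases hx : x ∈ W <;> simp [hx]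
  have e1 (k : ℕ) : superlevel (f + indicator W) ((k + 1 : ℕ) : ℝ≥0∞) =
      superlevel f ((k + 1 : ℕ) : ℝ≥0∞) ⊔ (superlevel f k ⊓ W) := by
    ext x
    obtain ⟨m, -, hm⟩ := hf x
    simp only [SetLike.mem_coe, mem_superlevel, Opens.mem_sup, Opens.mem_inf, hadd, hm]
    by_cases hx : x ∈ W
    · simp only [hx, if_true, and_true]
      norm_cast
      omega
    · simp [hx]
  have m0 := ν.modular' (superlevel f 0) W
  have m1 (k : ℕ) := ν.modular' (superlevel f ((k + 1 : ℕ) : ℝ≥0∞)) (superlevel f k ⊓ W)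
  have i1 (k : ℕ) : superlevel f ((k + 1 : ℕ) : ℝ≥0∞) ⊓ (superlevel f k ⊓ W) =
      superlevel f ((k + 1 : ℕ) : ℝ≥0∞) ⊓ W := by
    rw [← inf_assoc, inf_eq_left.2 (superlevel_anti f (by simp))]
  simp_rw [← e1, i1] at m1
  rw [← e0] at m0
  have hsplit (F : ℕ → ℝ≥0∞) : ∑' k, F k = F 0 + ∑' k, F (k + 1) :=
    tsum_eq_zero_add' ENNReal.summable
  -- If `ν(W) = ∞`, no cancellation is possible, but `W ⊆ {f + 1_W > 0}` already makes the left side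
  -- infinite.
  rcases eq_or_ne (ν.toFun W) ∞ with hW | hW
  · rw [hW, add_top, eq_top_iff, ← hW]
    refine (ν.mono' _ _ (e0 ▸ le_sup_right)).trans ?_
    rw [upperSum]
    simpa only [Nat.cast_zero] using ENNReal.le_tsum (f := fun k : ℕ =>
      ν.toFun (superlevel (f + indicator W) k)) 0
  · set S := ∑' k : ℕ, ν.toFun (superlevel f k ⊓ W) with hS
    have hfin : S ≠ ∞ := by
      rw [hS, tsum_eq_sum (s := Finset.range n)]
      · exact ENNReal.sum_ne_top.2 fun k _ =>
          ne_top_of_le_ne_top hW (ν.mono' _ _ inf_le_right)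
      · intro k hk
        convert ν.strict'
        refine le_bot_iff.1 fun x hx => ?_
        obtain ⟨m, hmn, hm⟩ := hf x
        have h1 : (k : ℝ≥0∞) < m := hm ▸ hx.1
        have h2 : k < m := by exact_mod_cast h1
        have h3 := Finset.mem_range.not.1 hk
        omega
    refine (ENNReal.add_left_inj hfin).1 ?_
    have hm : ∑' k : ℕ, ν.toFun (superlevel (f + indicator W) ((k + 1 : ℕ) : ℝ≥0∞)) +
        ∑' k : ℕ, ν.toFun (superlevel f ((k + 1 : ℕ) : ℝ≥0∞) ⊓ W) =
        ∑' k : ℕ, ν.toFun (superlevel f ((k + 1 : ℕ) : ℝ≥0∞)) + S := by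
      rw [hS, ← ENNReal.tsum_add, ← ENNReal.tsum_add]
      exact tsum_congr m1
    calc ν.upperSum (f + indicator W) + S
        = (ν.toFun (superlevel (f + indicator W) 0) + ν.toFun (superlevel f 0 ⊓ W)) +
          (∑' k : ℕ, ν.toFun (superlevel (f + indicator W) ((k + 1 : ℕ) : ℝ≥0∞)) +
          ∑' k : ℕ, ν.toFun (superlevel f ((k + 1 : ℕ) : ℝ≥0∞) ⊓ W)) := by
          rw [upperSum, hS, hsplit, hsplit (fun k => ν.toFun (superlevel f k ⊓ W))]
          simp only [Nat.cast_zero]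
          abel
      _ = ν.upperSum f + ν.toFun W + S := by
          rw [m0, hm, upperSum, hsplit fun k => ν.toFun (superlevel f k)]
          simp only [Nat.cast_zero]
          abel

theorem upperSum_sum_indicator {ι : Type*} (s : Finset ι) (U : ι → Opens X) :
    ν.upperSum (∑ i ∈ s, indicator (U i)) = ∑ i ∈ s, ν.toFun (U i) := by
  classical
  induction s using Finset.induction_on with
  | empty =>
    have h (k : ℕ) : superlevel (0 : Lsc X) k = ⊥ := le_bot_iff.1 fun x hx =>
      absurd (show (k : ℝ≥0∞) < 0 from hx) not_lt_zero
    simp [upperSum, h, ν.strict']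
  | insert i s hi ih =>
    rw [Finset.sum_insert hi, Finset.sum_insert hi, add_comm, add_comm (ν.toFun _), ← ih]
    -- At `x` the partial sum counts the `i ∈ s` with `x ∈ U i`, hence is a natural number at most
    -- `s.card`.
    refine ν.upperSum_add_indicator _ _ s.card fun x => ⟨(s.filter fun i => x ∈ U i).card,
      Finset.card_filter_le _ _, ?_⟩
    simp [coe_sum_apply, indicator_apply]

theorem upperSum_indicatorSum {ι : Type*} (U : ι → Opens X) :
    ν.upperSum (indicatorSum U) = ∑' i, ν.toFun (U i) := by
  rw [indicatorSum_eq_iSup, ν.scottContinuous_upperSum.map_lscSup (directed_sum _),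
    ENNReal.tsum_eq_iSup_sum]
  exact iSup_congr fun s => ν.upperSum_sum_indicator s U

theorem upperSum_floor (g : Lsc X) : ν.upperSum (floor g) = ν.lowerSum g :=
  ν.upperSum_indicatorSum _

theorem upperSum_floor_add_floor (f g : Lsc X) :
    ν.upperSum (floor f + floor g) = ν.lowerSum f + ν.lowerSum g := by
  rw [floor, floor, ← indicatorSum_add, upperSum_indicatorSum,
    Summable.tsum_sum ENNReal.summable ENNReal.summable]
  rfl

theorem lowerSum_add_le (f g : Lsc X) : ν.lowerSum f + ν.lowerSum g ≤ ν.lowerSum (f + g) := by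
  rw [← upperSum_floor_add_floor, ← upperSum_floor]
  exact ν.scottContinuous_upperSum.monotone (floor_add_le f g)

/-- The lower Riemann sum of mesh `2⁻ⁿ` for the integral of `g`. -/
noncomputable def dyadicSum (n : ℕ) (g : Lsc X) : ℝ≥0∞ :=
  (2 ^ n : ℝ≥0∞)⁻¹ * ν.lowerSum ((2 : ℝ≥0∞) ^ n • g)

theorem scottContinuous_dyadicSum (n : ℕ) : ScottContinuous (ν.dyadicSum n) :=
  (ν.scottContinuous_lowerSum.comp_smul _).const_mul_ennreal _

theorem monotone_dyadicSum (g : Lsc X) : Monotone fun n => ν.dyadicSum n g := by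
  refine monotone_nat_of_le_succ fun n => ?_
  rw [dyadicSum, ← ENNReal.inv_two_pow_succ_mul_add_self, dyadicSum]
  gcongr
  refine (ν.lowerSum_add_le _ _).trans_eq ?_
  rw [← add_smul, ← two_mul, ← pow_succ']

theorem dyadicSum_add_le (n : ℕ) (f g : Lsc X) :
    ν.dyadicSum n f + ν.dyadicSum n g ≤ ν.dyadicSum n (f + g) := by
  rw [dyadicSum, dyadicSum, dyadicSum, ← mul_add, smul_add]
  gcongr
  exact ν.lowerSum_add_le _ _

/-- After scaling by `2ⁿ` both approximants become floors, on whose sum the upper sum is exact; the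
lower sum is no larger. -/
theorem dyadicSum_dyadic_add_le (n : ℕ) (f g : Lsc X) :
    ν.dyadicSum n (dyadic n f + dyadic n g) ≤ ν.dyadicSum n f + ν.dyadicSum n g := by
  have h (g : Lsc X) : (2 : ℝ≥0∞) ^ n • dyadic n g = floor ((2 : ℝ≥0∞) ^ n • g) := by
    rw [dyadic, smul_smul, ENNReal.mul_inv_cancel (by simp) (by simp), one_smul]
  rw [dyadicSum, dyadicSum, dyadicSum, ← mul_add, smul_add, h, h, ← upperSum_floor_add_floor]
  gcongr
  exact ν.lowerSum_le_upperSum _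

/-- The integral as a supremum of dyadic lower Riemann sums. -/
noncomputable def riemannIntegral (g : Lsc X) : ℝ≥0∞ := ⨆ n, ν.dyadicSum n g

theorem scottContinuous_riemannIntegral : ScottContinuous ν.riemannIntegral :=
  ScottContinuous.iSup_ennreal fun _ => ν.scottContinuous_dyadicSum _

theorem riemannIntegral_add (f g : Lsc X) :
    ν.riemannIntegral (f + g) = ν.riemannIntegral f + ν.riemannIntegral g := by
  have hsup : f + g = Lsc.iSup fun n => dyadic n f + dyadic n g := by
    conv_lhs => rw [← iSup_dyadic f, ← iSup_dyadic g]
    exact Subtype.ext <| funext fun x => ENNReal.iSup_add_iSup_of_monotone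
      (fun _ _ h => monotone_dyadic f h x) (fun _ _ h => monotone_dyadic g h x)
  have hmono : Monotone fun n => dyadic n f + dyadic n g := fun m n h x =>
    add_le_add (monotone_dyadic f h x) (monotone_dyadic g h x)
  apply le_antisymm
  -- Two indices occur: `m` for the mesh of the sum, `n` for the approximants. Both are raised to
  -- `max m n`, where `dyadicSum_dyadic_add_le` applies.
  · refine iSup_le fun m => ?_
    rw [hsup, (ν.scottContinuous_dyadicSum m).map_lscSup hmono.directed_le]
    refine iSup_le fun n => ?_
    calc ν.dyadicSum m (dyadic n f + dyadic n g)
        ≤ ν.dyadicSum m (dyadic (max m n) f + dyadic (max m n) g) :=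
          (ν.scottContinuous_dyadicSum m).monotone (hmono (le_max_right m n))
      _ ≤ ν.dyadicSum (max m n) (dyadic (max m n) f + dyadic (max m n) g) :=
          ν.monotone_dyadicSum _ (le_max_left m n)
      _ ≤ ν.dyadicSum (max m n) f + ν.dyadicSum (max m n) g := ν.dyadicSum_dyadic_add_le _ _ _
      _ ≤ ν.riemannIntegral f + ν.riemannIntegral g :=
          add_le_add (le_iSup (fun n => ν.dyadicSum n f) _) (le_iSup (fun n => ν.dyadicSum n g) _)
  · rw [riemannIntegral, riemannIntegral,
      ENNReal.iSup_add_iSup_of_monotone (ν.monotone_dyadicSum f) (ν.monotone_dyadicSum g)]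
    exact iSup_mono fun n => ν.dyadicSum_add_le n f g

theorem riemannIntegral_smul_indicator (r : ℝ≥0∞) (U : Opens X) :
    ν.riemannIntegral (r • indicator U) = r * ν.toFun U := by
  classical
  -- The first rewrite expands `r` on both sides; the last folds it back on the left. At level `n`,
  -- the set `{2ⁿ r 1_U > k+1}` is `U` or empty, so the sum counts the `k` with `k+1 < 2ⁿ r`.
  rw [← ENNReal.iSup_dyadic_countBelow r, ENNReal.iSup_mul, ENNReal.iSup_dyadic_countBelow]
  refine iSup_congr fun n => ?_
  rw [dyadicSum, mul_assoc, lowerSum, ENNReal.countBelow, ← ENNReal.tsum_mul_right, smul_smul]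
  congr 1
  refine tsum_congr fun k => ?_
  have h : ∀ x, ((2 ^ n * r) • indicator U).1 x = if x ∈ U then 2 ^ n * r else 0 := fun x => by
    change (2 ^ n * r) * (indicator U).1 x = _
    simp [indicator_apply]
  split_ifs with hk
  · rw [one_mul]
    congr 1
    ext x
    by_cases hx : x ∈ U <;> simp [h, hx, hk]
  · rw [zero_mul]
    convert ν.strict'
    ext x
    by_cases hx : x ∈ U <;> simp [h, hx, hk]

/-! ### The lower integral as the dyadic integral, and its linearity -/

theorem le_pairing {g : Lsc X} {n : ℕ} (r : Fin n → ℝ≥0∞) (U : Fin n → Opens X)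
    (h : ∑ i, r i • indicator (U i) ≤ g) : ∑ i, r i * ν.toFun (U i) ≤ ν.pairing g :=
  le_sSup ⟨n, r, U, fun x => (coe_sum_apply _ _ x).symm.trans_le (h x), rfl⟩

/-- Additivity makes the dyadic integral exact on simple functions, so monotonicity bounds the lower
integral by it. Conversely, finite truncations of a dyadic sum come from simple functions below
`dyadic n g ≤ g`. -/
theorem pairing_eq_riemannIntegral (g : Lsc X) : ν.pairing g = ν.riemannIntegral g := by
  apply le_antisymm
  · refine sSup_le ?_
    rintro _ ⟨n, r, U, h, rfl⟩
    have hsum : ν.riemannIntegral (∑ i, r i • indicator (U i)) = ∑ i, r i * ν.toFun (U i) := by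
      simp_rw [← riemannIntegral_smul_indicator]
      let I : Lsc X →+ ℝ≥0∞ :=
        { toFun := ν.riemannIntegral
          map_zero' := by simpa using ν.riemannIntegral_smul_indicator 0 ⊥
          map_add' := ν.riemannIntegral_add }
      exact map_sum I _ _
    rw [← hsum]
    refine ν.scottContinuous_riemannIntegral.monotone fun x => ?_
    rw [coe_sum_apply]
    exact h x
  · refine iSup_le fun n => ?_
    rw [dyadicSum, lowerSum, ENNReal.tsum_eq_iSup_nat, ENNReal.mul_iSup]
    refine iSup_le fun N => ?_
    rw [← Fin.sum_univ_eq_sum_range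
      (fun k => ν.toFun (superlevel ((2 : ℝ≥0∞) ^ n • g) (k + 1))), Finset.mul_sum]
    refine ν.le_pairing _ _ (le_trans (fun x => ?_) ((isLUB_iSup _).1 ⟨n, rfl⟩ |>.trans_eq (iSup_dyadic g)))
    rw [coe_sum_apply]
    change ∑ i : Fin N, (2 ^ n : ℝ≥0∞)⁻¹ * (indicator (superlevel ((2 : ℝ≥0∞) ^ n • g) (i + 1))).1 x
      ≤ (2 ^ n : ℝ≥0∞)⁻¹ * ∑' k : ℕ, (indicator (superlevel ((2 : ℝ≥0∞) ^ n • g) (k + 1))).1 x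
    rw [← Finset.mul_sum, Fin.sum_univ_eq_sum_range
      (fun k => (indicator (superlevel ((2 : ℝ≥0∞) ^ n • g) (k + 1))).1 x)]
    gcongr
    exact ENNReal.sum_le_tsum _

theorem scottContinuous_pairing : ScottContinuous ν.pairing := by
  rw [show ν.pairing = ν.riemannIntegral from funext ν.pairing_eq_riemannIntegral]
  exact ν.scottContinuous_riemannIntegral

theorem pairing_indicator (U : Opens X) : ν.pairing (indicator U) = ν.toFun U := by
  simpa [← pairing_eq_riemannIntegral] using ν.riemannIntegral_smul_indicator 1 U

theorem pairing_add (f g : Lsc X) : ν.pairing (f + g) = ν.pairing f + ν.pairing g := by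
  simp_rw [pairing_eq_riemannIntegral, riemannIntegral_add]

theorem mul_pairing_le (c : ℝ≥0∞) (g : Lsc X) : c * ν.pairing g ≤ ν.pairing (c • g) := by
  rw [pairing, ENNReal.mul_sSup]
  refine iSup₂_le ?_
  rintro _ ⟨n, r, U, h, rfl⟩
  rw [Finset.mul_sum]
  simp_rw [← mul_assoc]
  refine ν.le_pairing _ _ fun x => ?_
  rw [coe_sum_apply]
  refine le_trans (le_of_eq ?_) (mul_le_mul_right (h x) c)
  rw [Finset.mul_sum]
  exact Finset.sum_congr rfl fun i _ => mul_assoc _ _ _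

theorem pairing_zero : ν.pairing 0 = 0 := by
  simpa using (ν.pairing_eq_riemannIntegral _).trans (ν.riemannIntegral_smul_indicator 0 ⊥)

theorem pairing_smul_of_ne_top {c : ℝ≥0∞} (hc : c ≠ ∞) (g : Lsc X) :
    ν.pairing (c • g) = c * ν.pairing g := by
  rcases eq_or_ne c 0 with rfl | h0
  · simp [pairing_zero]
  · refine le_antisymm ?_ (ν.mul_pairing_le c g)
    -- Applying the easy inequality to the scalar `c⁻¹` gives the reverse one.
    have h := mul_le_mul_right (ν.mul_pairing_le c⁻¹ (c • g)) c
    rwa [smul_smul, ENNReal.inv_mul_cancel h0 hc, one_smul, ← mul_assoc,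
      ENNReal.mul_inv_cancel h0 hc, one_mul] at h

theorem pairing_smul (c : ℝ≥0∞) (g : Lsc X) : ν.pairing (c • g) = c * ν.pairing g := by
  rcases eq_or_ne c ∞ with rfl | hc
  -- The scalar `∞` has no inverse; it is reached as the supremum of the natural numbers, by Scott
  -- continuity.
  · have h : (∞ : ℝ≥0∞) • g = Lsc.iSup fun n : ℕ => (n : ℝ≥0∞) • g :=
      Subtype.ext <| funext fun x => by
        change ∞ * g.1 x = ⨆ n : ℕ, (n : ℝ≥0∞) * g.1 x
        rw [← ENNReal.iSup_mul, ENNReal.iSup_natCast]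
    have hm : Monotone fun n : ℕ => (n : ℝ≥0∞) • g := fun m n hmn x =>
      mul_le_mul_left (by exact_mod_cast hmn : (m : ℝ≥0∞) ≤ n) _
    rw [h, ν.scottContinuous_pairing.map_lscSup hm.directed_le]
    simp_rw [fun n : ℕ => ν.pairing_smul_of_ne_top (ENNReal.natCast_ne_top n) g]
    rw [← ENNReal.iSup_mul, ENNReal.iSup_natCast]
  · exact ν.pairing_smul_of_ne_top hc g

/-! ### Duality between valuations and functionals -/

theorem isLinearMap_pairing : IsLinearMap ℝ≥0∞ ν.pairing where
  map_add := ν.pairing_add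
  map_smul := ν.pairing_smul

theorem ext_of_pairing {ν ρ : ContinuousValuation X} (h : ∀ g, ν.pairing g = ρ.pairing g) :
    ν = ρ := by
  ext U
  rw [← pairing_indicator, ← pairing_indicator, h]

/-- The continuous valuation represented by a Scott-continuous linear functional. -/
noncomputable def ofFunctional (Φ : Lsc X → ℝ≥0∞) (hl : IsLinearMap ℝ≥0∞ Φ)
    (hs : ScottContinuous Φ) : ContinuousValuation X where
  toFun U := Φ (indicator U)
  strict' := by
    rw [show indicator (⊥ : Opens X) = 0 from Subtype.ext (by simp [indicator]; rfl)]
    exact hl.map_zero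
  mono' U V h := hs.monotone (Set.indicator_le_indicator_of_subset h fun _ => zero_le_one)
  modular' U V := by
    rw [← hl.map_add, ← hl.map_add]
    congr 1
    exact Subtype.ext (Set.indicator_union_add_inter _ _ _)
  scott' S hne hS := by
    have : Nonempty S := hne.to_subtype
    have h : indicator (sSup S) = Lsc.iSup fun U : S => indicator U.1 :=
      Subtype.ext <| funext fun x => by
        classical
        change _ = ⨆ U : S, (indicator U.1).1 x
        simp only [indicator_apply, Opens.mem_sSup]
        split_ifs with hx
        · obtain ⟨U, hU, hxU⟩ := hx
          exact le_antisymm (le_iSup_of_le ⟨U, hU⟩ (by simp [hxU]))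
            (iSup_le fun V => by split_ifs <;> simp)
        · refine (le_bot_iff.1 (iSup_le fun U => ?_)).symm
          rw [if_neg fun h => hx ⟨U.1, U.2, h⟩]
          exact bot_le
    rw [h, hs.map_lscSup, iSup_subtype']
    intro U V
    obtain ⟨W, hW, h1, h2⟩ := hS U.1 U.2 V.1 V.2
    exact ⟨⟨W, hW⟩, Set.indicator_le_indicator_of_subset h1 fun _ => zero_le_one,
      Set.indicator_le_indicator_of_subset h2 fun _ => zero_le_one⟩

theorem pairing_ofFunctional (Φ : Lsc X → ℝ≥0∞) (hl : IsLinearMap ℝ≥0∞ Φ)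
    (hs : ScottContinuous Φ) : (ofFunctional Φ hl hs).pairing = Φ :=
  IsLinearMap.ext_of_scottContinuous (isLinearMap_pairing _) (scottContinuous_pairing _) hl hs
    fun U => pairing_indicator _ U

theorem bijOn_pairing :
    Set.BijOn (fun (ν : ContinuousValuation X) (g : Lsc X) => ν.pairing g) Set.univ
      {Φ : Lsc X → ℝ≥0∞ | IsLinearMap ℝ≥0∞ Φ ∧ ScottContinuous Φ} :=
  ⟨fun ν _ => ⟨ν.isLinearMap_pairing, ν.scottContinuous_pairing⟩,
    fun _ _ _ _ h => ext_of_pairing (congrFun h),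
    fun Φ h => ⟨ofFunctional Φ h.1 h.2, trivial, pairing_ofFunctional Φ h.1 h.2⟩⟩

end ContinuousValuation

/-- Precomposition of a lower semicontinuous function with a continuous map. -/
def Lsc.comp {X Y : Type u} [TopologicalSpace X] [TopologicalSpace Y] (g : Lsc Y) (f : C(X, Y)) :
    Lsc X :=
  ⟨fun x => g.1 (f x), LowerSemicontinuous.comp g.2 f.continuous⟩

/-! ### Change of variables, unit, multiplication and the monad laws -/

namespace ContinuousValuation

open Lsc

variable {X Y : Type u} [TopologicalSpace X] [TopologicalSpace Y]

/-- Both sides are linear and Scott-continuous in `g`, so comparison on indicators suffices. -/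
theorem pairing_pushforward (f : C(X, Y)) (ν : ContinuousValuation X) (g : Lsc Y) :
    (pushforward f ν).pairing g = ν.pairing (Lsc.comp g f) := by
  refine congrFun (IsLinearMap.ext_of_scottContinuous (isLinearMap_pairing _)
    (scottContinuous_pairing _) (Ψ := fun g => ν.pairing (Lsc.comp g f)) ⟨fun g h => ?_, fun c g => ?_⟩
    (scottContinuous_of_map_iSup fun _ _ g hg => ?_) fun U => ?_) g
  · exact ν.pairing_add (Lsc.comp g f) (Lsc.comp h f)
  · exact ν.pairing_smul c (Lsc.comp g f)
  · exact ν.scottContinuous_pairing.map_lscSup (g := fun i => Lsc.comp (g i) f)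
      fun i j => (hg i j).imp fun _ hk => ⟨fun x => hk.1 (f x), fun x => hk.2 (f x)⟩
  · rw [pairing_indicator]
    exact (ν.pairing_indicator (Opens.comap f U)).symm

/-- The Dirac valuation at a point. -/
noncomputable def dirac (x : X) : ContinuousValuation X :=
  ofFunctional (fun g => g.1 x) ⟨fun _ _ => rfl, fun _ _ => rfl⟩ (scottContinuous_eval x)

theorem pairing_dirac (x : X) (g : Lsc X) : (dirac x).pairing g = g.1 x :=
  congrFun (pairing_ofFunctional _ _ _) g

theorem continuous_dirac : Continuous (dirac : X → ContinuousValuation X) := by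
  refine continuous_generateFrom_iff.2 ?_
  rintro _ ⟨U, r, rfl⟩
  exact (superlevel (indicator U) r).isOpen

/-- The valuation on `X` obtained by averaging a valuation on the space of valuations. -/
noncomputable def join (ξ : ContinuousValuation (ContinuousValuation X)) :
    ContinuousValuation X :=
  ofFunctional (fun g => ξ.pairing (evalLsc g))
    ⟨fun f g => (congrArg ξ.pairing (Subtype.ext (funext fun ν => ν.pairing_add f g))).trans
        (ξ.pairing_add (evalLsc f) (evalLsc g)),
      fun c g => (congrArg ξ.pairing (Subtype.ext (funext fun ν => ν.pairing_smul c g))).trans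
        (ξ.pairing_smul c (evalLsc g))⟩
    (scottContinuous_of_map_iSup fun _ _ g hg => by
      have h : evalLsc (Lsc.iSup g) = Lsc.iSup fun i => evalLsc (g i) :=
        Subtype.ext (funext fun ν => ν.scottContinuous_pairing.map_lscSup hg)
      rw [h]
      exact ξ.scottContinuous_pairing.map_lscSup fun i j => (hg i j).imp fun _ hk =>
        ⟨fun ν => ν.scottContinuous_pairing.monotone hk.1,
          fun ν => ν.scottContinuous_pairing.monotone hk.2⟩)

theorem pairing_join (ξ : ContinuousValuation (ContinuousValuation X)) (g : Lsc X) :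
    (join ξ).pairing g = ξ.pairing (evalLsc g) :=
  congrFun (pairing_ofFunctional _ _ _) g

theorem continuous_join :
    Continuous (join : ContinuousValuation (ContinuousValuation X) → ContinuousValuation X) := by
  refine continuous_generateFrom_iff.2 ?_
  rintro _ ⟨U, r, rfl⟩
  -- By construction `join ξ` takes the value `⟨ξ, ⟨-, 1_U⟩⟩` on `U`, which is lower semicontinuous
  -- in `ξ`.
  exact (superlevel (evalLsc (evalLsc (indicator U))) r).isOpen

theorem pushforward_dirac (f : C(X, Y)) (x : X) : pushforward f (dirac x) = dirac (f x) :=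
  ext_of_pairing fun g => by rw [pairing_pushforward, pairing_dirac, pairing_dirac]; rfl

theorem pushforward_join (f : C(X, Y)) (ξ : ContinuousValuation (ContinuousValuation X)) :
    pushforward f (join ξ) = join (pushforward ⟨pushforward f, continuous_pushforward f⟩ ξ) :=
  ext_of_pairing fun g => by
    rw [pairing_pushforward, pairing_join, pairing_join, pairing_pushforward]
    exact congrArg ξ.pairing (Subtype.ext (funext fun ν => (pairing_pushforward f ν g).symm))

theorem join_pushforward_join
    (ζ : ContinuousValuation (ContinuousValuation (ContinuousValuation X))) :
    join (pushforward ⟨join, continuous_join⟩ ζ) = join (join ζ) :=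
  ext_of_pairing fun g => by
    rw [pairing_join, pairing_join, pairing_join, pairing_pushforward]
    exact congrArg ζ.pairing (Subtype.ext (funext fun ξ => pairing_join ξ g))

theorem join_dirac (ν : ContinuousValuation X) : join (dirac ν) = ν :=
  ext_of_pairing fun g => by rw [pairing_join, pairing_dirac]; rfl

theorem join_pushforward_dirac (ν : ContinuousValuation X) :
    join (pushforward ⟨dirac, continuous_dirac⟩ ν) = ν :=
  ext_of_pairing fun g => by
    rw [pairing_join, pairing_pushforward]
    exact congrArg ν.pairing (Subtype.ext (funext fun x => pairing_dirac x g))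

end ContinuousValuation

open ContinuousValuation

/-- The monad of continuous valuations on topological spaces. -/
noncomputable def valuationMonad : Monad TopCat.{u} where
  toFunctor := valuationFunctor
  η :=
    { app _ := TopCat.ofHom ⟨dirac, continuous_dirac⟩
      naturality _ _ f := TopCat.hom_ext <| ContinuousMap.ext fun x =>
        (pushforward_dirac f.hom x).symm }
  μ :=
    { app X := TopCat.ofHom (Y := ContinuousValuation X) ⟨join, continuous_join⟩
      naturality _ _ f := TopCat.hom_ext <| ContinuousMap.ext fun ξ =>
        (pushforward_join f.hom ξ).symm }
  assoc _ := TopCat.hom_ext <| ContinuousMap.ext join_pushforward_join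
  left_unit _ := TopCat.hom_ext <| ContinuousMap.ext join_dirac
  right_unit _ := TopCat.hom_ext <| ContinuousMap.ext join_pushforward_dirac

theorem mainTheorem4 :
    -- duality between valuations and Scott-continuous linear functionals
    (∀ X : TopCat.{u},
      Set.BijOn (fun (ν : ContinuousValuation X) (g : Lsc X) => ν.pairing g) Set.univ
        {Φ : Lsc X → ℝ≥0∞ | IsLinearMap ℝ≥0∞ Φ ∧ ScottContinuous Φ}) ∧
    -- the unit, the multiplication and the monad
    ∃ (δ : 𝟭 TopCat.{u} ⟶ valuationFunctor.{u})
      (E : valuationFunctor.{u} ⋙ valuationFunctor.{u} ⟶ valuationFunctor.{u}),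
      (∀ (X : TopCat.{u}) (x : X) (ν : ContinuousValuation X),
        ν = δ.app X x ↔ ∀ g : Lsc X, ν.pairing g = g.1 x) ∧
      (∀ (X : TopCat.{u}) (ξ : ContinuousValuation (ContinuousValuation X))
        (ν : ContinuousValuation X),
        ν = E.app X ξ ↔
          ∀ g : Lsc X, ν.pairing g = ξ.pairing (ContinuousValuation.evalLsc g)) ∧
      ∃ M : Monad TopCat.{u},
        M.toFunctor = valuationFunctor.{u} ∧ HEq M.η δ ∧ HEq M.μ E := by
  refine ⟨fun X => bijOn_pairing, valuationMonad.η, valuationMonad.μ, fun X x ν => ?_,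
    fun X ξ ν => ?_, valuationMonad, rfl, HEq.rfl, HEq.rfl⟩
  · exact ⟨fun h g => h ▸ pairing_dirac x g,
      fun h => ext_of_pairing fun g => (h g).trans (pairing_dirac x g).symm⟩
  · exact ⟨fun h g => h ▸ pairing_join ξ g,
      fun h => ext_of_pairing fun g => (h g).trans (pairing_join ξ g).symm⟩
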